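/- **Theorem (deviations in the super Gaussian regime).** *Setting.* Let $b:\mathbb R^d\to\mathbb R^d$ and $\sigma:\mathbb R^d\to\mathbb R^{d\times r}$ be Lipschitz continuous, put $\Sigma=\sigma\sigma^*$, and assume that $\sup_x \mathrm{Tr}\,\Sigma(x)<\infty$. Let $$\mathcal A f(x)=b(x)\cdot\nabla f(x)+\tfrac12\mathrm{Tr}\big(\Sigma(x)D^2f(x)\big)$$ be the generator of $dY_t=b(Y_t)\,dt+\sigma(Y_t)\,dW_t$. Write $\|\cdot\|$ for the Frobenius norm, $\|\zeta\|_\infty=\sup_x\|\zeta(x)\|$ for a bounded matrix field $\zeta$, and $[f]_1=\sup_{x\ne y}|f(x)-f(y)|/|x-y|$. Assume the following. * *Lyapunov condition.* There are $V:\mathbb R^d\to[v^*,\infty)$ with $v^*>0$ and constants $C_V,\alpha_V>0$, $\beta_V\ge0$ such that $V\in\mathcal C^2$, $\|D^2V\|_\infty<\infty$, $V(x)\to+\infty$ as $|x|\to\infty$, $|\nabla V|^2+|b|^2\le C_VV$ and $\mathcal AV\le-\alpha_VV+\beta_V$. * *Invariant measure.* The diffusion has a unique invariant probability measure $\nu$;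 write $\nu(f)=\int f\,d\nu$. * *Test functions.* Let $\beta\in(0,1]$. The functions $\varphi$ and $\vartheta$ both satisfy the following conditions on a function $f:\mathbb R^d\to\mathbb R$: $f\in\mathcal C^3$, its derivatives of orders $1,2,3$ are bounded, and its third derivatives are $\beta$-Hölder continuous; $x\mapsto b(x)\cdot\nabla f(x)$ is Lipschitz continuous; and $|f|\le C(1+\sqrt V)$ for some constant $C>0$. Moreover, on $\mathbb R^d$, $$\mathcal A\vartheta=|\sigma^*\nabla\varphi|^2-\nu\big(|\sigma^*\nabla\varphi|^2\big).$$ * *Steps.* Let $\theta\in(\frac1{2+\beta},1]$ and let $(\gamma_k)_{k\ge1}$ be positive with $\gamma_k\asymp k^{-\theta}$, i.e. $C^{-1}k^{-\theta}\le\gamma_k\le Ck^{-\theta}$ for some $C\ge 1$ and all large $k$. Assume that for all $k\ge1$ $$\gamma_k\le\min\Big(\frac1{2\sqrt{C_V\bar c}},\ \frac{\alpha_V}{2C_V\|D^2V\|_\infty}\Big),$$ where $\bar c>0$ is a constant such that $V(x)\le\bar c|x|^2$ outside some ball. Put $\Gamma_n=\sum_{k=1}^n\gamma_k$. * *Random input.*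 The random variables $(U_k)_{k\ge1}$ in $\mathbb R^r$ are i.i.d. and independent of $X_0$, with $\mathbb E[U_1^i]=0$, $\mathbb E[U_1^iU_1^j]=\delta_{ij}$ and $\mathbb E[U_1^iU_1^jU_1^k]=0$, and $$\mathbb E\,e^{\lambda g(U_1)}\le e^{\lambda\mathbb E[g(U_1)]+\lambda^2/2}\qquad\text{for all } 1\text{-Lipschitz } g:\mathbb R^r\to\mathbb R \text{ and all } \lambda>0.$$ There are $\lambda_0>0$ and a finite function $M$ with $\mathbb E\,e^{\lambda|X_0|^2}\le M(\lambda)$ for all $\lambda<\lambda_0$. Consider the Euler scheme and the integrals against its empirical measure $$X_{n+1}=X_n+\gamma_{n+1}b(X_n)+\sqrt{\gamma_{n+1}}\,\sigma(X_n)U_{n+1},\qquad \nu_n(f)=\frac1{\Gamma_n}\sum_{k=1}^n\gamma_kf(X_{k-1}).$$ *Conclusion.* For every real sequence $R_n\to+\infty$ there are non-negative sequences $(c_n)$ and $(C_n)$, respectively non-decreasing and non-increasing for $n$ large enough, with $\lim_nc_n=\lim_nC_n=1$, such that for all $n\ge1$ and all $a>0$ with $\dfrac a{\sqrt{\Gamma_n}}\ge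 R_n$ (super Gaussian deviations), $$\mathbb P\big[\,|\sqrt{\Gamma_n}\,\nu_n(\mathcal A\varphi)|\ge a\,\big]\le 2\,C_n\exp\Big(-c_n\,\frac{a^{4/3}\,\Gamma_n^{1/3}}{2\,\|\sigma\|_\infty^{2/3}\,[\vartheta]_1^{2/3}}\Big).$$ The sequences $(c_n),(C_n)$ depend only on $b,\sigma,V$ and its constants, $\nu,\varphi,\vartheta,\beta,\theta,(\gamma_k),\lambda_0,M$ and $(R_n)$; they do not depend on $a$, on the probability space, on the law of $U_1$, or otherwise on the law of $X_0$. In particular, if $a=a_n>0$ and $a_n/\sqrt{\Gamma_n}\to+\infty$, the bound holds at $a=a_n$ for all $n\ge1$ (take $R_n=a_n/\sqrt{\Gamma_n}$). In the degenerate case $\|\sigma\|_\infty[\vartheta]_1=0$ the quotient in the exponent is read as $0$. -/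

import Mathlib

open MeasureTheory ProbabilityTheory Filter Topology
open scoped NNReal ENNReal Matrix

namespace EulerErgodic

noncomputable section

/-- The Euclidean space `ℝᵈ`. -/
abbrev E (d : ℕ) : Type := EuclideanSpace ℝ (Fin d)

/-! ### Norms, derivatives, Hölder spaces -/

/-- The Frobenius norm `Tr (M M*) ^ (1/2)` of a matrix. -/
def frob {m n : ℕ} (M : Matrix (Fin m) (Fin n) ℝ) : ℝ :=
  Real.sqrt (M * Mᵀ).trace

/-- The uniform norm `sup_x ‖ζ x‖` of a matrix field, for the Frobenius norm.  It is used only for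
fields that are assumed to be bounded. -/
def supNorm {d m n : ℕ} (ζ : E d → Matrix (Fin m) (Fin n) ℝ) : ℝ :=
  ⨆ x, frob (ζ x)

/-- The Hessian matrix `D²f(x) = (∂ᵢ∂ⱼ f(x))`. -/
def hess {d : ℕ} (f : E d → ℝ) (x : E d) : Matrix (Fin d) (Fin d) ℝ :=
  Matrix.of fun i j =>
    iteratedFDeriv ℝ 2 f x ![EuclideanSpace.single i 1, EuclideanSpace.single j 1]

/-- The modulus `[f]_β = sup_{x ≠ y} |f x - f y| / |x - y| ^ β`, for `β > 0` (pairs with `x = y`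
contribute `0`).  It is used only for functions for which the supremum is finite. -/
def holderModulus {d : ℕ} (β : ℝ) (f : E d → ℝ) : ℝ :=
  ⨆ p : E d × E d, |f p.1 - f p.2| / ‖p.1 - p.2‖ ^ β

/-- `f ∈ 𝒞^{k,β}(ℝᵈ, ℝ)`: `f` is `k` times continuously differentiable, its derivatives of order
`1, …, k` are bounded (`f` itself need not be), and the derivative of order `k` is
`β`-Hölder continuous. -/
structure MemHolder {d : ℕ} (k : ℕ) (β : ℝ) (f : E d → ℝ) : Prop where
  contDiff : ContDiff ℝ k f
  bounded : ∀ j, 1 ≤ j → j ≤ k → ∃ C : ℝ, ∀ x, ‖iteratedFDeriv ℝ j f x‖ ≤ C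
  holder : ∃ C : ℝ, ∀ x y,
    ‖iteratedFDeriv ℝ k f x - iteratedFDeriv ℝ k f y‖ ≤ C * ‖x - y‖ ^ β

/-! ### The diffusion `dY = b(Y) dt + σ(Y) dW` -/

/-- The generator `𝒜f(x) = b(x) · ∇f(x) + ½ Tr (σσ*(x) D²f(x))`. -/
def generator {d r : ℕ} (b : E d → E d) (σ : E d → Matrix (Fin d) (Fin r) ℝ)
    (f : E d → ℝ) (x : E d) : ℝ :=
  inner ℝ (b x) (gradient f x) + 1 / 2 * (σ x * (σ x)ᵀ * hess f x).trace

/-- The energy density `|σ*∇f|²(x)`. -/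
def carreDuChamp {d r : ℕ} (σ : E d → Matrix (Fin d) (Fin r) ℝ) (f : E d → ℝ) (x : E d) : ℝ :=
  ‖(WithLp.toLp 2 ((σ x)ᵀ *ᵥ (gradient f x).ofLp) : E r)‖ ^ 2

/-- `Y` is a (weak) solution of `dY = b(Y) dt + σ(Y) dW`, in the sense of the martingale problem:
`Y` is a continuous adapted process, and `f(Y_t) - f(Y_0) - ∫₀ᵗ 𝒜f(Y_s) ds` is a martingale for
every smooth compactly supported `f`. -/
structure IsWeakSolution {d r : ℕ} (b : E d → E d) (σ : E d → Matrix (Fin d) (Fin r) ℝ)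
    {Ω : Type} [mΩ : MeasurableSpace Ω] (P : Measure Ω) (𝓖 : Filtration ℝ≥0 mΩ)
    (Y : ℝ≥0 → Ω → E d) : Prop where
  adapted : ∀ t, Measurable[𝓖 t] (Y t)
  continuous : ∀ ω, Continuous fun t => Y t ω
  martingale : ∀ f : E d → ℝ, ContDiff ℝ (⊤ : ℕ∞) f → HasCompactSupport f →
    Martingale
      (fun (t : ℝ≥0) ω => f (Y t ω) - f (Y 0 ω)
        - ∫ s in (0 : ℝ)..(t : ℝ), generator b σ f (Y s.toNNReal ω)) 𝓖 P

/-- `ν` is an invariant probability measure of the diffusion: there is a solution all of whose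
one-dimensional marginals are `ν`. -/
def IsInvariant {d r : ℕ} (b : E d → E d) (σ : E d → Matrix (Fin d) (Fin r) ℝ)
    (ν : Measure (E d)) : Prop :=
  IsProbabilityMeasure ν ∧
    ∃ (Ω : Type) (mΩ : MeasurableSpace Ω) (P : Measure Ω) (𝓖 : Filtration ℝ≥0 mΩ)
      (Y : ℝ≥0 → Ω → E d),
      IsProbabilityMeasure P ∧ IsWeakSolution b σ P 𝓖 Y ∧ ∀ t, P.map (Y t) = ν

/-- `ν` is the unique invariant probability measure of the diffusion. -/
def IsUniqueInvariant {d r : ℕ} (b : E d → E d) (σ : E d → Matrix (Fin d) (Fin r) ℝ)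
    (ν : Measure (E d)) : Prop :=
  IsInvariant b σ ν ∧ ∀ ν' : Measure (E d), IsInvariant b σ ν' → ν' = ν

/-! ### Assumptions on the coefficients, the Lyapunov function and the test functions -/

/-- `b` and `σ` are Lipschitz continuous and `σ` is bounded. -/
structure Coefficients {d r : ℕ} (b : E d → E d)
    (σ : E d → Matrix (Fin d) (Fin r) ℝ) : Prop where
  lipschitz_b : ∃ L : ℝ≥0, LipschitzWith L b
  lipschitz_σ : ∃ L : ℝ, ∀ x y, frob (σ x - σ y) ≤ L * ‖x - y‖
  bounded_σ : ∃ κ : ℝ, 0 < κ ∧ ∀ x, (σ x * (σ x)ᵀ).trace ≤ κ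

/-- The Lyapunov condition, with its constants. -/
structure Lyapunov {d r : ℕ} (b : E d → E d) (σ : E d → Matrix (Fin d) (Fin r) ℝ)
    (V : E d → ℝ) (CV αV βV : ℝ) : Prop where
  lower : ∃ v : ℝ, 0 < v ∧ ∀ x, v ≤ V x
  contDiff : ContDiff ℝ 2 V
  bounded_hess : BddAbove (Set.range fun x => frob (hess V x))
  tendsto : Tendsto V (cocompact (E d)) atTop
  CV_pos : 0 < CV
  growth : ∀ x, ‖gradient V x‖ ^ 2 + ‖b x‖ ^ 2 ≤ CV * V x
  αV_pos : 0 < αV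
  βV_nonneg : 0 ≤ βV
  drift : ∀ x, generator b σ V x ≤ -αV * V x + βV

/-- The smoothness and growth conditions on a test function. -/
structure IsTestFunction {d : ℕ} (b : E d → E d) (V : E d → ℝ) (β : ℝ) (φ : E d → ℝ) : Prop where
  memHolder : MemHolder 3 β φ
  lipschitz : ∃ L : ℝ≥0, LipschitzWith L fun x => inner ℝ (b x) (gradient φ x)
  growth : ∃ C : ℝ, 0 < C ∧ ∀ x, |φ x| ≤ C * (1 + Real.sqrt (V x))

/-! ### Steps -/

/-- The step sequence `(γ_k)_{k ≥ 1}` (the value `γ 0` is never used) is positive,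
`γ_k ≍ k ^ (-θ)`, and it is small with respect to the coefficients and the Lyapunov function.
The constant `cbar` is one for which `V(x) ≤ cbar |x|²` (hence `|b(x)| ≤ √(CV cbar) |x|`) for all
large `x`. -/
structure Steps {d : ℕ} (V : E d → ℝ) (CV αV θ : ℝ) (γ : ℕ → ℝ) : Prop where
  pos : ∀ k, 1 ≤ k → 0 < γ k
  order : ∃ C : ℝ, 1 ≤ C ∧ ∃ n₀ : ℕ, ∀ n : ℕ, 1 ≤ n → n₀ ≤ n →
    C⁻¹ * (n : ℝ) ^ (-θ) ≤ γ n ∧ γ n ≤ C * (n : ℝ) ^ (-θ)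
  small : ∃ K cbar : ℝ, 0 < K ∧ 0 < cbar ∧ (∀ x, K ≤ ‖x‖ → V x ≤ cbar * ‖x‖ ^ 2) ∧
    ∀ k, 1 ≤ k → γ k ≤ min (1 / (2 * Real.sqrt (CV * cbar))) (αV / (2 * CV * supNorm (hess V)))

/-- `Γ_n = γ_1 + … + γ_n`. -/
def Gam (γ : ℕ → ℝ) (n : ℕ) : ℝ := ∑ k ∈ Finset.range n, γ (k + 1)

/-! ### Innovations, the scheme and its empirical measure -/

/-- The law `μ` on `ℝʳ` has the moments of the standard Gaussian law up to order three and
satisfies the Gaussian concentration property for `1`-Lipschitz functions. -/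
structure InnovationLaw {r : ℕ} (μ : Measure (E r)) : Prop where
  prob : IsProbabilityMeasure μ
  moment_one : ∀ i, ∫ u, u i ∂μ = 0
  moment_two : ∀ i j, ∫ u, u i * u j ∂μ = if i = j then 1 else 0
  moment_three : ∀ i j k, ∫ u, u i * u j * u k ∂μ = 0
  concentration : ∀ g : E r → ℝ, LipschitzWith 1 g → ∀ l : ℝ, 0 < l →
    Integrable (fun u => Real.exp (l * g u)) μ ∧
      ∫ u, Real.exp (l * g u) ∂μ ≤ Real.exp (l * (∫ u, g u ∂μ) + l ^ 2 / 2)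

/-- The random input of the scheme on a probability space: `(U_k)_{k ≥ 1}` are i.i.d. with law `μ`
(`U 0` is never used) and independent of `X₀`; and `X₀` is sub-Gaussian, with threshold `l₀` and
with `𝔼 exp (l |X₀|²) ≤ M l < ∞` for `l < l₀`. -/
structure RandomInput {d r : ℕ} {Ω : Type*} [MeasurableSpace Ω] (P : Measure Ω)
    (μ : Measure (E r)) (l₀ : ℝ) (M : ℝ → ℝ≥0) (X₀ : Ω → E d) (U : ℕ → Ω → E r) : Prop where
  prob : IsProbabilityMeasure P
  measurable_X₀ : Measurable X₀
  measurable_U : ∀ k, Measurable (U (k + 1))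
  law_U : ∀ k, P.map (U (k + 1)) = μ
  indep_U : iIndepFun (fun k => U (k + 1)) P
  indep_X₀ : IndepFun X₀ (fun ω k => U (k + 1) ω) P
  subGaussian : ∀ l : ℝ, l < l₀ →
    ∫⁻ ω, ENNReal.ofReal (Real.exp (l * ‖X₀ ω‖ ^ 2)) ∂P ≤ M l

/-- The Euler scheme with decreasing steps,
`X_{n+1} = X_n + γ_{n+1} b(X_n) + √γ_{n+1} σ(X_n) U_{n+1}`. -/
def scheme {d r : ℕ} {Ω : Type*} (b : E d → E d) (σ : E d → Matrix (Fin d) (Fin r) ℝ)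
    (γ : ℕ → ℝ) (X₀ : Ω → E d) (U : ℕ → Ω → E r) : ℕ → Ω → E d
  | 0 => X₀
  | n + 1 => fun ω =>
      let x := scheme b σ γ X₀ U n ω
      x + γ (n + 1) • b x
        + Real.sqrt (γ (n + 1)) • (WithLp.toLp 2 (σ x *ᵥ (U (n + 1) ω).ofLp) : E d)

/-- The integral `ν_n(f) = (∑_{k=1}^n γ_k f(X_{k-1})) / Γ_n` of `f` against the empirical
measure, along a sequence `X`. -/
def empirical {d : ℕ} (γ : ℕ → ℝ) (X : ℕ → E d) (n : ℕ) (f : E d → ℝ) : ℝ :=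
  (∑ k ∈ Finset.range n, γ (k + 1) * f (X k)) / Gam γ n

end

end EulerErgodic

open EulerErgodic

/-!
# Deviations of the empirical measure in the super Gaussian regime

In the regime `a / √Γₙ ≥ Rₙ → ∞` the claimed rate is of lower order than `a²`: since
`Γₙ ≤ a² / Rₙ²`, one has `a^{4/3} Γₙ^{1/3} ≤ a² Rₙ^{-2/3}`.  Any inequality
`ℙ(… ≥ a) ≤ B exp (D Γₙ - l a²)`, with arbitrary constants `B`, `D` and `l > 0` that do not depend
on `a` and `n`, therefore gives the theorem with `cₙ = Cₙ = 1` as soon as `Rₙ` exceeds a threshold;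
for the finitely many smaller `n` one takes `cₙ = 0` and the bound is trivial.  This comparison is
`exists_exp_le_of_large`.

The non-sharp inequality (`exists_deviation_le`) comes from the Lyapunov function alone.

* As `|𝒜φ| ≤ C √V` (`exists_abs_generator_le`), the Cauchy–Schwarz inequality with weights `γₖ`
  gives `|√Γₙ νₙ(𝒜φ)|² ≤ C² ∑ γₖ V(Xₖ₋₁)` (`abs_sqrt_mul_empirical_sq_le`), so that it is enough to
  bound the exponential moments of the occupation sum of `V`.
* A Taylor expansion of `V` along one step, the drift condition and the smallness of the steps give
  `𝔼 [exp (l V(Xₖ₊₁) + q γₖ₊₁ V(Xₖ)) | Xₖ] ≤ exp (l V(Xₖ) + D γₖ₊₁)` for small `l` and `q = l αV / 4`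
  (`exists_lintegral_exp_step_le`).  The innovation enters through
  `𝔼 exp (⟨w, U⟩ + s |U|²) ≤ exp (|w|² + D s)`, which holds with constants that are uniform over all
  laws with Gaussian concentration (`exists_lintegral_exp_inner_add_sq_le`).
* By independence of `Uₖ₊₁` and the past these estimates multiply up to
  `𝔼 exp (q ∑ γₖ V(Xₖ₋₁)) ≤ exp (D Γₙ) 𝔼 exp (l V(X₀))` (`lintegral_exp_occupation_le`); the last
  factor is finite since `V` grows at most quadratically and `X₀` is sub-Gaussian.  Markov's
  inequality concludes.
-/

namespace EulerErgodic

/-! ### Matrices, Hessians and the generator -/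

lemma trace_mul_transpose_nonneg {m n : ℕ} (M : Matrix (Fin m) (Fin n) ℝ) :
    0 ≤ (M * Mᵀ).trace := by
  simp only [Matrix.trace, Matrix.diag, Matrix.mul_apply, Matrix.transpose_apply]
  exact Finset.sum_nonneg fun i _ => Finset.sum_nonneg fun j _ => mul_self_nonneg _

lemma frob_sq {m n : ℕ} (M : Matrix (Fin m) (Fin n) ℝ) : frob M ^ 2 = (M * Mᵀ).trace :=
  Real.sq_sqrt (trace_mul_transpose_nonneg M)

lemma frob_nonneg {m n : ℕ} (M : Matrix (Fin m) (Fin n) ℝ) : 0 ≤ frob M := Real.sqrt_nonneg _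

lemma frob_transpose {m n : ℕ} (M : Matrix (Fin m) (Fin n) ℝ) : frob Mᵀ = frob M := by
  rw [frob, frob, Matrix.transpose_transpose, Matrix.trace_mul_comm]

lemma abs_apply_le_frob {m n : ℕ} (M : Matrix (Fin m) (Fin n) ℝ) (i : Fin m) (j : Fin n) :
    |M i j| ≤ frob M := by
  refine abs_le_of_sq_le_sq ?_ (frob_nonneg M)
  rw [frob_sq]
  simp only [Matrix.trace, Matrix.diag, Matrix.mul_apply, Matrix.transpose_apply, ← sq]
  calc M i j ^ 2 ≤ ∑ j, M i j ^ 2 :=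
        Finset.single_le_sum (f := fun j => M i j ^ 2) (fun _ _ => sq_nonneg _) (Finset.mem_univ j)
    _ ≤ _ := Finset.single_le_sum (f := fun i => ∑ j, M i j ^ 2)
        (fun _ _ => Finset.sum_nonneg fun _ _ => sq_nonneg _) (Finset.mem_univ i)

/-- The Frobenius norm dominates the Euclidean operator norm. -/
lemma norm_mulVec_le {m n : ℕ} (M : Matrix (Fin m) (Fin n) ℝ) (u : E n) :
    ‖(WithLp.toLp 2 (M *ᵥ u.ofLp) : E m)‖ ≤ frob M * ‖u‖ := by
  refine le_of_sq_le_sq ?_ (mul_nonneg (frob_nonneg M) (norm_nonneg u))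
  rw [mul_pow, frob_sq, EuclideanSpace.real_norm_sq_eq, EuclideanSpace.real_norm_sq_eq]
  simp only [Matrix.trace, Matrix.diag, Matrix.mul_apply, Matrix.transpose_apply, ← sq,
    Matrix.mulVec, dotProduct, Finset.sum_mul]
  refine Finset.sum_le_sum fun i _ => ?_
  rw [← Finset.sum_mul]
  exact Finset.sum_mul_sq_le_sq_mul_sq _ _ _

/-- The Hessian matrix represents the second derivative as a quadratic form. -/
lemma iteratedFDeriv_two_eq_sum {d : ℕ} (f : E d → ℝ) (x h : E d) :
    iteratedFDeriv ℝ 2 f x ![h, h] = ∑ i, ∑ j, h i * h j * hess f x i j := by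
  have hh : h = ∑ i, h i • EuclideanSpace.single i (1 : ℝ) := by
    ext k
    simp [Pi.single_apply]
  simp only [hess, Matrix.of_apply, iteratedFDeriv_two_apply, Matrix.cons_val_zero,
    Matrix.cons_val_one]
  conv_lhs => rw [hh]
  simp only [map_sum, map_smul, sum_apply, smul_apply,
    smul_eq_mul, Finset.mul_sum]
  exact Finset.sum_comm.trans
    (Finset.sum_congr rfl fun i _ => Finset.sum_congr rfl fun j _ => by ring)

lemma iteratedFDeriv_two_le_frob {d : ℕ} (f : E d → ℝ) (x h : E d) :
    |iteratedFDeriv ℝ 2 f x ![h, h]| ≤ frob (hess f x) * ‖h‖ ^ 2 := by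
  have h1 : iteratedFDeriv ℝ 2 f x ![h, h]
      = inner ℝ (WithLp.toLp 2 (hess f x *ᵥ h.ofLp) : E d) h := by
    rw [iteratedFDeriv_two_eq_sum, PiLp.inner_apply]
    refine Finset.sum_congr rfl fun i _ => ?_
    simp only [Matrix.mulVec, dotProduct, RCLike.inner_apply, conj_trivial, Finset.mul_sum]
    exact Finset.sum_congr rfl fun j _ => by ring
  rw [h1]
  calc _ ≤ _ := abs_real_inner_le_norm _ _
    _ ≤ frob (hess f x) * ‖h‖ * ‖h‖ :=
      mul_le_mul_of_nonneg_right (norm_mulVec_le _ _) (norm_nonneg _)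
    _ = _ := by ring

/-- The second-order term of the generator is the sum over the columns `σₖ` of `σ` of
`D²f(σₖ, σₖ)`, so a bound on the quadratic form `D²f` bounds it. -/
lemma abs_trace_mul_hess_le {d r : ℕ} (M : Matrix (Fin d) (Fin r) ℝ) (f : E d → ℝ) (x : E d)
    {C : ℝ} (hC : ∀ h, |iteratedFDeriv ℝ 2 f x ![h, h]| ≤ C * ‖h‖ ^ 2) :
    |(M * Mᵀ * hess f x).trace| ≤ C * (M * Mᵀ).trace := by
  have h1 : (M * Mᵀ * hess f x).trace = ∑ k, iteratedFDeriv ℝ 2 f x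
      ![(WithLp.toLp 2 fun i => M i k), (WithLp.toLp 2 fun i => M i k)] := by
    simp only [iteratedFDeriv_two_eq_sum]
    rw [Matrix.trace_mul_comm]
    simp only [Matrix.trace, Matrix.diag, Matrix.mul_apply, Matrix.transpose_apply,
      Finset.mul_sum]
    rw [Finset.sum_comm' (t' := Finset.univ) (s' := fun _ => Finset.univ) (by simp)]
    rw [Finset.sum_congr rfl fun j _ => Finset.sum_comm, Finset.sum_comm]
    refine Finset.sum_congr rfl fun k _ => ?_
    rw [Finset.sum_comm]
    exact Finset.sum_congr rfl fun i _ => Finset.sum_congr rfl fun j _ => by ring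
  have h2 : (M * Mᵀ).trace = ∑ k, ‖(WithLp.toLp 2 fun i => M i k : E d)‖ ^ 2 := by
    simp only [EuclideanSpace.real_norm_sq_eq, Matrix.trace, Matrix.diag, Matrix.mul_apply,
      Matrix.transpose_apply, ← sq]
    exact Finset.sum_comm
  rw [h1, h2, Finset.mul_sum]
  exact (Finset.abs_sum_le_sum_abs _ _).trans (Finset.sum_le_sum fun k _ => hC _)

lemma norm_gradient_eq {d : ℕ} (f : E d → ℝ) (x : E d) : ‖gradient f x‖ = ‖fderiv ℝ f x‖ := by
  simp [gradient]

/-- A `C²` function lies below its quadratic Taylor polynomial with the Hessian replaced by a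
bound on it. -/
lemma le_add_inner_gradient_add_sq {d : ℕ} {f : E d → ℝ} (hf : ContDiff ℝ 2 f) {H : ℝ}
    (hH : ∀ x, frob (hess f x) ≤ H) (x h : E d) :
    f (x + h) ≤ f x + inner ℝ (gradient f x) h + H / 2 * ‖h‖ ^ 2 := by
  have hline : ∀ t : ℝ, HasDerivAt (fun t : ℝ => x + t • h) h t := fun t => by
    simpa using ((hasDerivAt_id t).smul_const h).const_add x
  have hf1 : Differentiable ℝ f := hf.differentiable (by norm_num)
  have hf2 : Differentiable ℝ (fderiv ℝ f) :=
    (hf.fderiv_right (m := 1) (by norm_num)).differentiable (by norm_num)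
  have hψ : ∀ t : ℝ, HasDerivAt (fun t : ℝ => fderiv ℝ f (x + t • h) h)
      (iteratedFDeriv ℝ 2 f (x + t • h) ![h, h]) t := fun t => by
    rw [iteratedFDeriv_two_apply]
    have h1 : HasDerivAt (fun t : ℝ => fderiv ℝ f (x + t • h))
        (fderiv ℝ (fderiv ℝ f) (x + t • h) h) t :=
      (hf2 (x + t • h)).hasFDerivAt.comp_hasDerivAt t (hline t)
    exact (ContinuousLinearMap.apply ℝ ℝ h).hasFDerivAt.comp_hasDerivAt t h1
  have hψle : ∀ t : ℝ, 0 ≤ t → fderiv ℝ f (x + t • h) h - fderiv ℝ f x h ≤ H * ‖h‖ ^ 2 * t := by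
    intro t ht
    have := image_sub_le_mul_sub_of_deriv_le (f := fun t : ℝ => fderiv ℝ f (x + t • h) h)
      (fun t => (hψ t).differentiableAt) (C := H * ‖h‖ ^ 2) (fun t => by
        rw [(hψ t).deriv]
        exact (le_abs_self _).trans ((iteratedFDeriv_two_le_frob f _ h).trans
          (mul_le_mul_of_nonneg_right (hH _) (sq_nonneg _)))) ht
    simpa using this
  have hg : ∀ t : ℝ, HasDerivAt
      (fun t : ℝ => f (x + t • h) - t * fderiv ℝ f x h - H / 2 * ‖h‖ ^ 2 * t ^ 2)
      (fderiv ℝ f (x + t • h) h - fderiv ℝ f x h - H * ‖h‖ ^ 2 * t) t := fun t => by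
    have h1 : HasDerivAt (fun t : ℝ => f (x + t • h)) (fderiv ℝ f (x + t • h) h) t :=
      (hf1 (x + t • h)).hasFDerivAt.comp_hasDerivAt t (hline t)
    have h2 : HasDerivAt (fun t : ℝ => t * fderiv ℝ f x h) (fderiv ℝ f x h) t := by
      simpa using (hasDerivAt_id t).mul_const (fderiv ℝ f x h)
    have h3 := (hasDerivAt_pow 2 t).const_mul (H / 2 * ‖h‖ ^ 2)
    exact ((h1.sub h2).sub h3).congr_deriv (by norm_num; ring)
  have hanti : AntitoneOn
      (fun t : ℝ => f (x + t • h) - t * fderiv ℝ f x h - H / 2 * ‖h‖ ^ 2 * t ^ 2)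
      (Set.Icc 0 1) := by
    refine antitoneOn_of_deriv_nonpos (convex_Icc 0 1)
      (fun t _ => (hg t).continuousAt.continuousWithinAt)
      (fun t _ => (hg t).differentiableAt.differentiableWithinAt) fun t ht => ?_
    rw [interior_Icc] at ht
    rw [(hg t).deriv]
    linarith [hψle t ht.1.le]
  have := hanti (Set.left_mem_Icc.2 zero_le_one) (Set.right_mem_Icc.2 zero_le_one) zero_le_one
  have hgrad : inner ℝ (gradient f x) h = fderiv ℝ f x h := by
    simp [gradient]
  simp only [one_smul, zero_smul, add_zero] at this
  rw [hgrad]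
  linarith

/-- Under the Lyapunov condition, `𝒜φ` grows at most like `√V`. -/
lemma exists_abs_generator_le {d r : ℕ} {b : E d → E d} {σ : E d → Matrix (Fin d) (Fin r) ℝ}
    {V : E d → ℝ} {CV αV βV β : ℝ} {φ : E d → ℝ} (hbσ : Coefficients b σ)
    (hV : Lyapunov b σ V CV αV βV) (hφ : IsTestFunction b V β φ) :
    ∃ C, 0 < C ∧ ∀ x, |generator b σ φ x| ≤ C * Real.sqrt (V x) := by
  obtain ⟨κ, hκ, hσ⟩ := hbσ.bounded_σ
  obtain ⟨v, hv, hVv⟩ := hV.lower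
  obtain ⟨C₁, hC₁⟩ := hφ.memHolder.bounded 1 le_rfl (by norm_num)
  obtain ⟨C₂, hC₂⟩ := hφ.memHolder.bounded 2 (by norm_num) (by norm_num)
  have hC₁0 : 0 ≤ C₁ := (norm_nonneg _).trans (hC₁ 0)
  have hC₂0 : 0 ≤ C₂ := (norm_nonneg _).trans (hC₂ 0)
  have hsv : 0 < Real.sqrt v := Real.sqrt_pos.2 hv
  refine ⟨Real.sqrt CV * C₁ + C₂ * κ / Real.sqrt v + 1, by positivity, fun x => ?_⟩
  have hVx : 0 < V x := hv.trans_le (hVv x)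
  have hb : ‖b x‖ ≤ Real.sqrt CV * Real.sqrt (V x) := by
    rw [← Real.sqrt_mul hV.CV_pos.le]
    refine Real.le_sqrt_of_sq_le ?_
    have := hV.growth x
    nlinarith [sq_nonneg ‖gradient V x‖]
  have h1 : |inner ℝ (b x) (gradient φ x)| ≤ Real.sqrt CV * Real.sqrt (V x) * C₁ := by
    refine (abs_real_inner_le_norm _ _).trans (mul_le_mul hb ?_ (norm_nonneg _) (by positivity))
    rw [norm_gradient_eq, ← norm_iteratedFDeriv_one]
    exact hC₁ x
  have h2 : |(σ x * (σ x)ᵀ * hess φ x).trace| ≤ C₂ * κ := by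
    refine (abs_trace_mul_hess_le (σ x) φ x fun h => ?_).trans
      (mul_le_mul_of_nonneg_left (hσ x) hC₂0)
    have := (iteratedFDeriv ℝ 2 φ x).le_opNorm ![h, h]
    simp only [Fin.prod_univ_two, Matrix.cons_val_zero, Matrix.cons_val_one,
      Real.norm_eq_abs] at this
    refine this.trans ?_
    rw [← sq]
    exact mul_le_mul_of_nonneg_right (hC₂ x) (sq_nonneg _)
  have h3 : C₂ * κ ≤ C₂ * κ / Real.sqrt v * Real.sqrt (V x) := by
    rw [div_mul_eq_mul_div, le_div_iff₀ hsv]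
    exact mul_le_mul_of_nonneg_left (Real.sqrt_le_sqrt (hVv x)) (by positivity)
  have h4 : |1 / 2 * (σ x * (σ x)ᵀ * hess φ x).trace| ≤ C₂ * κ := by
    rw [abs_mul, abs_of_pos (by norm_num : (0 : ℝ) < 1 / 2)]
    linarith [abs_nonneg (σ x * (σ x)ᵀ * hess φ x).trace]
  have := abs_add_le (inner ℝ (b x) (gradient φ x)) (1 / 2 * (σ x * (σ x)ᵀ * hess φ x).trace)
  rw [generator]
  nlinarith [Real.sqrt_nonneg (V x)]

/-- Cauchy–Schwarz with the weights `γₖ` turns the growth of `f` into control of the normalized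
empirical integral by the occupation sum of `V`. -/
lemma abs_sqrt_mul_empirical_sq_le {d : ℕ} {V f : E d → ℝ} {C : ℝ}
    (hV : ∀ x, 0 ≤ V x) (hf : ∀ x, |f x| ≤ C * Real.sqrt (V x)) {γ : ℕ → ℝ}
    (hγ : ∀ k, 1 ≤ k → 0 < γ k) (X : ℕ → E d) (n : ℕ) :
    |Real.sqrt (Gam γ n) * empirical γ X n f| ^ 2
      ≤ C ^ 2 * ∑ k ∈ Finset.range n, γ (k + 1) * V (X k) := by
  have hγ0 : ∀ k, 0 ≤ γ (k + 1) := fun k => (hγ _ (by omega)).le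
  have hG : 0 ≤ Gam γ n := Finset.sum_nonneg fun k _ => hγ0 k
  have hS : 0 ≤ ∑ k ∈ Finset.range n, γ (k + 1) * V (X k) :=
    Finset.sum_nonneg fun k _ => mul_nonneg (hγ0 k) (hV _)
  have hsum : (∑ k ∈ Finset.range n, γ (k + 1) * f (X k)) ^ 2
      ≤ C ^ 2 * (Gam γ n * ∑ k ∈ Finset.range n, γ (k + 1) * V (X k)) := by
    have h1 : |∑ k ∈ Finset.range n, γ (k + 1) * f (X k)|
        ≤ C * ∑ k ∈ Finset.range n, Real.sqrt (γ (k + 1)) *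
          (Real.sqrt (γ (k + 1)) * Real.sqrt (V (X k))) := by
      rw [Finset.mul_sum]
      refine (Finset.abs_sum_le_sum_abs _ _).trans (Finset.sum_le_sum fun k _ => ?_)
      rw [abs_mul, abs_of_nonneg (hγ0 k), ← mul_assoc (Real.sqrt _), Real.mul_self_sqrt (hγ0 k)]
      have := mul_le_mul_of_nonneg_left (hf (X k)) (hγ0 k)
      linarith
    have h2 := Finset.sum_mul_sq_le_sq_mul_sq (Finset.range n) (fun k => Real.sqrt (γ (k + 1)))
      (fun k => Real.sqrt (γ (k + 1)) * Real.sqrt (V (X k)))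
    simp only [mul_pow, Real.sq_sqrt (hγ0 _), Real.sq_sqrt (hV _)] at h2
    calc _ = |∑ k ∈ Finset.range n, γ (k + 1) * f (X k)| ^ 2 := (sq_abs _).symm
      _ ≤ _ := pow_le_pow_left₀ (abs_nonneg _) h1 2
      _ ≤ _ := by
        rw [mul_pow]
        exact mul_le_mul_of_nonneg_left h2 (sq_nonneg C)
  rw [sq_abs, mul_pow, Real.sq_sqrt hG, empirical, div_pow]
  rcases hG.eq_or_lt with h0 | h0
  · rw [← h0]
    simp only [zero_mul]
    positivity
  · rw [mul_div_assoc', div_le_iff₀ (by positivity)]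
    nlinarith

/-! ### Exponential moments of the innovations -/

lemma InnovationLaw.integrable_sq {r : ℕ} {μ : Measure (E r)} (hμ : InnovationLaw μ) (i : Fin r) :
    Integrable (fun u : E r => u i * u i) μ := by
  by_contra h
  -- a non-integrable square would have integral `0`, while the second moment is `1`
  have := hμ.moment_two i i
  rw [integral_undef h] at this
  simp at this

lemma InnovationLaw.integrable_coord {r : ℕ} {μ : Measure (E r)} (hμ : InnovationLaw μ)
    (i : Fin r) : Integrable (fun u : E r => u i) μ := by
  have := hμ.prob
  refine ((hμ.integrable_sq i).add (integrable_const (1 : ℝ))).mono'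
    (by fun_prop : Measurable fun u : E r => u i).aestronglyMeasurable (ae_of_all _ fun u => ?_)
  simp only [Pi.add_apply, Real.norm_eq_abs]
  exact abs_le.2 ⟨by nlinarith [sq_nonneg (u i + 1 / 2)], by nlinarith [sq_nonneg (u i - 1 / 2)]⟩

lemma InnovationLaw.integral_inner {r : ℕ} {μ : Measure (E r)} (hμ : InnovationLaw μ) (w : E r) :
    ∫ u, inner ℝ w u ∂μ = 0 := by
  simp only [PiLp.inner_apply, RCLike.inner_apply, conj_trivial]
  rw [integral_finsetSum _ fun i _ => (hμ.integrable_coord i).mul_const _]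
  simp [integral_mul_const, hμ.moment_one]

lemma InnovationLaw.integral_norm_le {r : ℕ} {μ : Measure (E r)} (hμ : InnovationLaw μ) :
    ∫ u, ‖u‖ ∂μ ≤ 1 + r := by
  have := hμ.prob
  have hint : Integrable (fun u : E r => 1 + ∑ i, u i * u i) μ :=
    (integrable_const 1).add (integrable_finsetSum _ fun i _ => hμ.integrable_sq i)
  calc ∫ u, ‖u‖ ∂μ ≤ ∫ u, (1 + ∑ i, u i * u i) ∂μ :=
        integral_mono_of_nonneg (ae_of_all _ fun u => norm_nonneg u) hint
          (ae_of_all _ fun u => by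
            have h := EuclideanSpace.real_norm_sq_eq u
            simp only [← sq]
            nlinarith [sq_nonneg (‖u‖ - 1 / 2)])
    _ = 1 + r := by
      rw [integral_add (integrable_const 1)
        (integrable_finsetSum _ fun i _ => hμ.integrable_sq i),
        integral_finsetSum _ fun i _ => hμ.integrable_sq i]
      simp [hμ.moment_two]

lemma InnovationLaw.lintegral_exp_mul_le {r : ℕ} {μ : Measure (E r)} (hμ : InnovationLaw μ)
    {g : E r → ℝ} (hg : LipschitzWith 1 g) {l m : ℝ} (hl : 0 ≤ l) (hm : ∫ u, g u ∂μ ≤ m) :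
    ∫⁻ u, ENNReal.ofReal (Real.exp (l * g u)) ∂μ
      ≤ ENNReal.ofReal (Real.exp (l * m + l ^ 2 / 2)) := by
  have := hμ.prob
  rcases hl.eq_or_lt with rfl | hl
  · simp
  obtain ⟨hi, hle⟩ := hμ.concentration g hg l hl
  rw [← ofReal_integral_eq_lintegral_ofReal hi (ae_of_all _ fun u => (Real.exp_pos _).le)]
  refine ENNReal.ofReal_le_ofReal (hle.trans (Real.exp_le_exp.2 ?_))
  nlinarith

lemma InnovationLaw.lintegral_exp_inner_le {r : ℕ} {μ : Measure (E r)} (hμ : InnovationLaw μ)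
    (w : E r) : ∫⁻ u, ENNReal.ofReal (Real.exp (inner ℝ w u)) ∂μ
      ≤ ENNReal.ofReal (Real.exp (‖w‖ ^ 2 / 2)) := by
  have := hμ.prob
  rcases eq_or_ne w 0 with rfl | hw
  · simp
  have hw' : ‖w‖ ≠ 0 := norm_ne_zero_iff.2 hw
  have hg : LipschitzWith 1 fun u : E r => inner ℝ (‖w‖⁻¹ • w) u := by
    refine LipschitzWith.of_dist_le_mul fun u v => ?_
    rw [Real.dist_eq, ← inner_sub_right, dist_eq_norm, NNReal.coe_one]
    refine (abs_real_inner_le_norm _ _).trans (le_of_eq ?_)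
    rw [norm_smul, norm_inv, norm_norm, inv_mul_cancel₀ hw']
  have := hμ.lintegral_exp_mul_le hg (norm_nonneg w) (hμ.integral_inner _).le
  simpa [real_inner_smul_left, mul_inv_cancel_left₀ hw'] using this

/-- A bound on `𝔼 exp (|U|² / 4)` valid for every innovation law in dimension `r`.  On
`{k ≤ |u| < k + 1}` one has `exp (|u|² / 4) ≤ exp ((k + 1)² / 4) exp (k (|u| - k))`, and the
concentration inequality for the norm bounds the integral by `exp (-k² / 4 + O(k))`. -/
lemma exists_lintegral_exp_sq_div_four_le (r : ℕ) : ∃ K : ℝ, 0 ≤ K ∧ ∀ μ : Measure (E r),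
    InnovationLaw μ →
      ∫⁻ u, ENNReal.ofReal (Real.exp (1 / 4 * ‖u‖ ^ 2)) ∂μ ≤ ENNReal.ofReal K := by
  have hsum : Summable fun k : ℕ => Real.exp ((r + 3) ^ 2 + 1) * Real.exp (-(k : ℝ)) :=
    Real.summable_exp_neg_nat.mul_left _
  refine ⟨∑' k : ℕ, Real.exp ((r + 3) ^ 2 + 1) * Real.exp (-(k : ℝ)),
    tsum_nonneg fun k => by positivity, fun μ hμ => ?_⟩
  have hpt : ∀ u : E r, ENNReal.ofReal (Real.exp (1 / 4 * ‖u‖ ^ 2)) ≤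
      ∑' k : ℕ, ENNReal.ofReal (Real.exp ((k + 1) ^ 2 / 4 - k ^ 2)) *
        ENNReal.ofReal (Real.exp (k * ‖u‖)) := by
    intro u
    refine le_trans ?_ (ENNReal.le_tsum ⌊‖u‖⌋₊)
    rw [← ENNReal.ofReal_mul (Real.exp_pos _).le, ← Real.exp_add]
    refine ENNReal.ofReal_le_ofReal (Real.exp_le_exp.2 ?_)
    have h1 := Nat.floor_le (norm_nonneg u)
    have h2 := Nat.lt_floor_add_one ‖u‖
    have h3 : (0 : ℝ) ≤ ⌊‖u‖⌋₊ := Nat.cast_nonneg _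
    nlinarith [norm_nonneg u, mul_nonneg h3 (sub_nonneg.2 h1)]
  calc ∫⁻ u, ENNReal.ofReal (Real.exp (1 / 4 * ‖u‖ ^ 2)) ∂μ
      ≤ ∫⁻ u, ∑' k : ℕ, ENNReal.ofReal (Real.exp ((k + 1) ^ 2 / 4 - k ^ 2)) *
        ENNReal.ofReal (Real.exp (k * ‖u‖)) ∂μ := lintegral_mono hpt
    _ = ∑' k : ℕ, ENNReal.ofReal (Real.exp ((k + 1) ^ 2 / 4 - k ^ 2)) *
        ∫⁻ u, ENNReal.ofReal (Real.exp (k * ‖u‖)) ∂μ := by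
      rw [lintegral_tsum fun k => by fun_prop]
      exact tsum_congr fun k => lintegral_const_mul _ (by fun_prop)
    _ ≤ ∑' k : ℕ, ENNReal.ofReal (Real.exp ((r + 3) ^ 2 + 1) * Real.exp (-(k : ℝ))) := by
      refine ENNReal.tsum_le_tsum fun k => ?_
      refine (mul_le_mul_right (hμ.lintegral_exp_mul_le lipschitzWith_one_norm
        (Nat.cast_nonneg k) hμ.integral_norm_le) _).trans ?_
      rw [← ENNReal.ofReal_mul (Real.exp_pos _).le, ← Real.exp_add, ← Real.exp_add]
      refine ENNReal.ofReal_le_ofReal (Real.exp_le_exp.2 ?_)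
      have : (0 : ℝ) ≤ r := Nat.cast_nonneg r
      nlinarith [sq_nonneg ((k : ℝ) / 2 - (r + 5 / 2))]
    _ = _ := (ENNReal.ofReal_tsum_of_nonneg (fun k => by positivity) hsum).symm

/-- Joint exponential moments of the linear and the quadratic part of an innovation, with
constants that do not depend on its law. -/
lemma exists_lintegral_exp_inner_add_sq_le (r : ℕ) : ∃ D : ℝ, 0 ≤ D ∧ ∀ μ : Measure (E r),
    InnovationLaw μ → ∀ (w : E r) (s : ℝ), 0 ≤ s → s ≤ 1 / 8 →
      ∫⁻ u, ENNReal.ofReal (Real.exp (inner ℝ w u + s * ‖u‖ ^ 2)) ∂μ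
        ≤ ENNReal.ofReal (Real.exp (‖w‖ ^ 2 + D * s)) := by
  obtain ⟨K, hK, hexp⟩ := exists_lintegral_exp_sq_div_four_le r
  refine ⟨4 * K, by positivity, fun μ hμ w s hs hs8 => ?_⟩
  have := hμ.prob
  -- convexity of `exp` interpolates between `0` and `|u|² / 4`
  have hsq : ∫⁻ u, ENNReal.ofReal (Real.exp (2 * s * ‖u‖ ^ 2)) ∂μ
      ≤ ENNReal.ofReal (Real.exp (2 * (4 * K * s))) := by
    have hpt : ∀ u : E r, ENNReal.ofReal (Real.exp (2 * s * ‖u‖ ^ 2)) ≤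
        1 + ENNReal.ofReal (8 * s) * ENNReal.ofReal (Real.exp (1 / 4 * ‖u‖ ^ 2)) := by
      intro u
      rw [← ENNReal.ofReal_one, ← ENNReal.ofReal_mul (by positivity),
        ← ENNReal.ofReal_add zero_le_one (by positivity)]
      refine ENNReal.ofReal_le_ofReal ?_
      have := convexOn_exp.2 (Set.mem_univ (0 : ℝ)) (Set.mem_univ (1 / 4 * ‖u‖ ^ 2))
        (by linarith : 0 ≤ 1 - 8 * s) (by positivity : 0 ≤ 8 * s) (by ring)
      simp only [smul_eq_mul, mul_zero, zero_add, Real.exp_zero, mul_one] at this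
      rw [show 8 * s * (1 / 4 * ‖u‖ ^ 2) = 2 * s * ‖u‖ ^ 2 by ring] at this
      linarith
    refine (lintegral_mono hpt).trans ?_
    rw [lintegral_add_left measurable_const, lintegral_const_mul _ (by fun_prop)]
    simp only [lintegral_const, measure_univ, mul_one]
    refine (add_le_add_right (mul_le_mul_right (hexp μ hμ) _) _).trans ?_
    rw [← ENNReal.ofReal_one, ← ENNReal.ofReal_mul (by positivity),
      ← ENNReal.ofReal_add zero_le_one (by positivity)]
    refine ENNReal.ofReal_le_ofReal ?_
    have := Real.add_one_le_exp (2 * (4 * K * s))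
    linarith
  have hlin : ∫⁻ u, ENNReal.ofReal (Real.exp (2 * inner ℝ w u)) ∂μ
      ≤ ENNReal.ofReal (Real.exp (2 * ‖w‖ ^ 2)) := by
    have := hμ.lintegral_exp_inner_le ((2 : ℝ) • w)
    simp only [real_inner_smul_left, norm_smul, Real.norm_ofNat] at this
    rwa [show (2 * ‖w‖) ^ 2 / 2 = 2 * ‖w‖ ^ 2 by ring] at this
  have hsqrt : ∀ y : ℝ, ENNReal.ofReal (Real.exp (2 * y)) ^ (1 / 2 : ℝ)
      = ENNReal.ofReal (Real.exp y) := fun y => by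
    rw [ENNReal.ofReal_rpow_of_pos (Real.exp_pos _), ← Real.exp_mul]
    ring_nf
  have hpow : ∀ y : ℝ, ENNReal.ofReal (Real.exp y) ^ (2 : ℝ)
      = ENNReal.ofReal (Real.exp (2 * y)) := fun y => by
    rw [ENNReal.ofReal_rpow_of_pos (Real.exp_pos _), ← Real.exp_mul, mul_comm]
  have hCS := ENNReal.lintegral_mul_le_Lp_mul_Lq μ Real.HolderConjugate.two_two
    (f := fun u : E r => ENNReal.ofReal (Real.exp (inner ℝ w u)))
    (g := fun u : E r => ENNReal.ofReal (Real.exp (s * ‖u‖ ^ 2))) (by fun_prop) (by fun_prop)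
  simp only [Pi.mul_apply, hpow, ← ENNReal.ofReal_mul (Real.exp_pos _).le, ← Real.exp_add] at hCS
  refine hCS.trans ?_
  rw [Real.exp_add, ENNReal.ofReal_mul (Real.exp_pos _).le, ← hsqrt (‖w‖ ^ 2),
    ← hsqrt (4 * K * s)]
  refine mul_le_mul' (ENNReal.rpow_le_rpow hlin (by norm_num))
    (ENNReal.rpow_le_rpow ?_ (by norm_num))
  simpa only [← mul_assoc] using hsq

/-! ### The exponential Lyapunov estimate for one step -/

lemma inner_mulVec_eq {m n : ℕ} (M : Matrix (Fin m) (Fin n) ℝ) (v : E m) (u : E n) :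
    inner ℝ v (WithLp.toLp 2 (M *ᵥ u.ofLp) : E m)
      = inner ℝ (WithLp.toLp 2 (Mᵀ *ᵥ v.ofLp) : E n) u := by
  simp only [PiLp.inner_apply, RCLike.inner_apply, conj_trivial, Matrix.mulVec, dotProduct,
    Matrix.transpose_apply, Finset.sum_mul, Finset.mul_sum]
  rw [Finset.sum_comm]
  exact Finset.sum_congr rfl fun i _ => Finset.sum_congr rfl fun j _ => by ring

/-- The steps are positive, so the bound `αV / (2 CV ‖D²V‖)` on them cannot be the junk value `0`
of a division by zero. -/
lemma supNorm_hess_pos {d : ℕ} {V : E d → ℝ} {CV αV θ : ℝ} {γ : ℕ → ℝ}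
    (hγ : Steps V CV αV θ γ) : 0 < supNorm (hess V) := by
  obtain ⟨K, cbar, -, -, -, h⟩ := hγ.small
  have h1 := (hγ.pos 1 le_rfl).trans_le ((h 1 le_rfl).trans (min_le_right _ _))
  refine lt_of_le_of_ne (Real.iSup_nonneg fun x => frob_nonneg _) fun h0 => ?_
  rw [← h0] at h1
  simp at h1

/-- The deterministic part of the Lyapunov estimate: the smallness of the step absorbs the
quadratic term `γ² |b|²` into half of the drift. -/
lemma Lyapunov.step_le {d r : ℕ} {b : E d → E d} {σ : E d → Matrix (Fin d) (Fin r) ℝ}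
    {V : E d → ℝ} {CV αV βV κ H : ℝ} (hV : Lyapunov b σ V CV αV βV)
    (hκ : ∀ x, (σ x * (σ x)ᵀ).trace ≤ κ) (hH : ∀ x, frob (hess V x) ≤ H) {g : ℝ} (hg : 0 < g)
    (hgle : g * (2 * CV * H) ≤ αV) (x ξ : E d) :
    V (x + g • b x + ξ) ≤ V x - αV / 2 * g * V x + g * (βV + H * κ / 2)
      + inner ℝ (gradient V x) ξ + H * ‖ξ‖ ^ 2 := by
  have hH0 : 0 ≤ H := (frob_nonneg _).trans (hH 0)
  obtain ⟨v, hv, hVv⟩ := hV.lower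
  have hVx : 0 < V x := hv.trans_le (hVv x)
  have h1 := le_add_inner_gradient_add_sq hV.contDiff hH x (g • b x + ξ)
  rw [← add_assoc, inner_add_right, real_inner_smul_right] at h1
  have h2 : |(σ x * (σ x)ᵀ * hess V x).trace| ≤ H * κ :=
    (abs_trace_mul_hess_le (σ x) V x fun h => (iteratedFDeriv_two_le_frob V x h).trans
      (mul_le_mul_of_nonneg_right (hH x) (sq_nonneg _))).trans
      (mul_le_mul_of_nonneg_left (hκ x) hH0)
  have h3 := hV.drift x
  rw [generator, real_inner_comm] at h3
  have h4 : inner ℝ (gradient V x) (b x) ≤ -αV * V x + (βV + H * κ / 2) := by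
    linarith [neg_abs_le (σ x * (σ x)ᵀ * hess V x).trace]
  have h5 : ‖g • b x + ξ‖ ^ 2 ≤ 2 * (g ^ 2 * ‖b x‖ ^ 2) + 2 * ‖ξ‖ ^ 2 := by
    have ha := norm_add_le (g • b x) ξ
    have hb : ‖g • b x‖ ^ 2 = g ^ 2 * ‖b x‖ ^ 2 := by
      rw [norm_smul, mul_pow, Real.norm_eq_abs, sq_abs]
    nlinarith [norm_nonneg (g • b x + ξ), sq_nonneg (‖g • b x‖ - ‖ξ‖)]
  have h6 : ‖b x‖ ^ 2 ≤ CV * V x := by nlinarith [hV.growth x, sq_nonneg ‖gradient V x‖]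
  have h7 : H * (g ^ 2 * ‖b x‖ ^ 2) ≤ αV / 2 * g * V x := by
    calc H * (g ^ 2 * ‖b x‖ ^ 2) ≤ H * (g ^ 2 * (CV * V x)) := by gcongr
      _ = g * (2 * CV * H) * (g * V x / 2) := by ring
      _ ≤ αV * (g * V x / 2) := mul_le_mul_of_nonneg_right hgle (by positivity)
      _ = _ := by ring
  have h8 := mul_le_mul_of_nonneg_left h4 hg.le
  have h9 := mul_le_mul_of_nonneg_left h5 (by positivity : 0 ≤ H / 2)
  linarith

/-- One step of the scheme contracts `exp (l V)` in the mean, leaving room for the occupation term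
`(l αV / 4) γ V`, at the cost of a factor `exp (D γ)`. -/
lemma exists_lintegral_exp_step_le {d r : ℕ} {b : E d → E d}
    {σ : E d → Matrix (Fin d) (Fin r) ℝ} {V : E d → ℝ} {CV αV βV θ : ℝ} {γ : ℕ → ℝ}
    (hbσ : Coefficients b σ) (hV : Lyapunov b σ V CV αV βV) (hγ : Steps V CV αV θ γ) :
    ∃ l₁, 0 < l₁ ∧ ∀ l, 0 < l → l ≤ l₁ → ∃ D, 0 ≤ D ∧ ∀ μ : Measure (E r), InnovationLaw μ →
      ∀ (k : ℕ) (x : E d),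
        ∫⁻ u, ENNReal.ofReal (Real.exp (l * V (x + γ (k + 1) • b x
            + Real.sqrt (γ (k + 1)) • (WithLp.toLp 2 (σ x *ᵥ u.ofLp) : E d))
            + l * αV / 4 * (γ (k + 1) * V x))) ∂μ
          ≤ ENNReal.ofReal (Real.exp (l * V x + D * γ (k + 1))) := by
  obtain ⟨κ, hκ0, hκ⟩ := hbσ.bounded_σ
  obtain ⟨v, hv, hVv⟩ := hV.lower
  have hH0 := supNorm_hess_pos hγ
  have hH : ∀ x, frob (hess V x) ≤ supNorm (hess V) := le_ciSup hV.bounded_hess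
  set H := supNorm (hess V)
  obtain ⟨D₀, hD₀, hexp⟩ := exists_lintegral_exp_inner_add_sq_le r
  have hCV := hV.CV_pos
  have hαV := hV.αV_pos
  have hβV := hV.βV_nonneg
  have hγle : ∀ k, γ (k + 1) * (2 * CV * H) ≤ αV := fun k => by
    obtain ⟨K, cbar, -, -, -, h⟩ := hγ.small
    exact (le_div_iff₀ (by positivity)).1 ((h (k + 1) (by omega)).trans (min_le_right _ _))
  -- the first bound makes the quadratic coefficient at most `1 / 8`, the second one makes the
  -- square of the linear coefficient at most half of the drift
  refine ⟨min (CV / (4 * κ * αV)) (αV / (4 * κ * CV)), by positivity, fun l hl hl₁ => ?_⟩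
  have hla : l * (4 * κ * αV) ≤ CV := (le_div_iff₀ (by positivity)).1 (hl₁.trans (min_le_left _ _))
  have hlb : l * (4 * κ * CV) ≤ αV :=
    (le_div_iff₀ (by positivity)).1 (hl₁.trans (min_le_right _ _))
  refine ⟨l * (βV + H * κ / 2) + D₀ * (l * H * κ), by positivity, fun μ hμ k x => ?_⟩
  have hg := hγ.pos (k + 1) (by omega)
  have hgle := hγle k
  generalize γ (k + 1) = g at hg hgle ⊢
  have hVx : 0 < V x := hv.trans_le (hVv x)
  set w : E r := (l * Real.sqrt g) • (WithLp.toLp 2 ((σ x)ᵀ *ᵥ (gradient V x).ofLp) : E r)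
  have hw : ‖w‖ ^ 2 ≤ l * αV / 4 * (g * V x) := by
    have h1 : ‖(WithLp.toLp 2 ((σ x)ᵀ *ᵥ (gradient V x).ofLp) : E r)‖ ^ 2 ≤ κ * (CV * V x) := by
      refine (pow_le_pow_left₀ (norm_nonneg _) (norm_mulVec_le _ _) 2).trans ?_
      rw [mul_pow, frob_transpose, frob_sq]
      have := hV.growth x
      exact mul_le_mul (hκ x) (by nlinarith [sq_nonneg ‖b x‖]) (sq_nonneg _) hκ0.le
    calc ‖w‖ ^ 2 = l ^ 2 * g * ‖(WithLp.toLp 2 ((σ x)ᵀ *ᵥ (gradient V x).ofLp) : E r)‖ ^ 2 := by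
          rw [norm_smul, mul_pow, Real.norm_eq_abs, sq_abs, mul_pow, Real.sq_sqrt hg.le]
      _ ≤ l ^ 2 * g * (κ * (CV * V x)) := by gcongr
      _ = l * (4 * κ * CV) * (l * g * V x / 4) := by ring
      _ ≤ αV * (l * g * V x / 4) := mul_le_mul_of_nonneg_right hlb (by positivity)
      _ = _ := by ring
  have hs8 : l * H * κ * g ≤ 1 / 8 := by
    have h1 : l * (4 * κ * αV) * (g * (2 * CV * H)) ≤ CV * αV :=
      mul_le_mul hla hgle (by positivity) hCV.le
    have h2 : CV * αV * (8 * (l * H * κ * g)) ≤ CV * αV * 1 := by linarith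
    linarith [le_of_mul_le_mul_left h2 (by positivity)]
  have hpt : ∀ u : E r, l * V (x + g • b x + Real.sqrt g • (WithLp.toLp 2 (σ x *ᵥ u.ofLp) : E d))
      + l * αV / 4 * (g * V x)
      ≤ (l * V x - l * αV / 4 * (g * V x) + l * (βV + H * κ / 2) * g)
        + (inner ℝ w u + l * H * κ * g * ‖u‖ ^ 2) := by
    intro u
    have h1 := hV.step_le hκ hH hg hgle x (Real.sqrt g • (WithLp.toLp 2 (σ x *ᵥ u.ofLp) : E d))
    have h2 : ‖Real.sqrt g • (WithLp.toLp 2 (σ x *ᵥ u.ofLp) : E d)‖ ^ 2 ≤ g * (κ * ‖u‖ ^ 2) := by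
      rw [norm_smul, mul_pow, Real.norm_eq_abs, sq_abs, Real.sq_sqrt hg.le]
      refine mul_le_mul_of_nonneg_left ?_ hg.le
      refine (pow_le_pow_left₀ (norm_nonneg _) (norm_mulVec_le _ _) 2).trans ?_
      rw [mul_pow, frob_sq]
      exact mul_le_mul_of_nonneg_right (hκ x) (sq_nonneg _)
    have h3 : inner ℝ w u
        = l * inner ℝ (gradient V x) (Real.sqrt g • (WithLp.toLp 2 (σ x *ᵥ u.ofLp) : E d)) := by
      rw [real_inner_smul_left, real_inner_smul_right, inner_mulVec_eq, mul_assoc]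
    have h4 := mul_le_mul_of_nonneg_left h2 hH0.le
    have h5 := mul_le_mul_of_nonneg_left (h1.trans (add_le_add_right h4 _)) hl.le
    rw [h3]
    linarith
  calc _ ≤ ∫⁻ u, ENNReal.ofReal (Real.exp (l * V x - l * αV / 4 * (g * V x)
          + l * (βV + H * κ / 2) * g)) *
          ENNReal.ofReal (Real.exp (inner ℝ w u + l * H * κ * g * ‖u‖ ^ 2)) ∂μ :=
        lintegral_mono fun u => by
          rw [← ENNReal.ofReal_mul (Real.exp_pos _).le, ← Real.exp_add]
          exact ENNReal.ofReal_le_ofReal (Real.exp_le_exp.2 (hpt u))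
    _ ≤ ENNReal.ofReal (Real.exp (l * V x - l * αV / 4 * (g * V x) + l * (βV + H * κ / 2) * g)) *
          ENNReal.ofReal (Real.exp (‖w‖ ^ 2 + D₀ * (l * H * κ * g))) := by
      rw [lintegral_const_mul _ (by fun_prop)]
      exact mul_le_mul_right (hexp μ hμ w _ (by positivity) hs8) _
    _ ≤ _ := by
      rw [← ENNReal.ofReal_mul (Real.exp_pos _).le, ← Real.exp_add]
      refine ENNReal.ofReal_le_ofReal (Real.exp_le_exp.2 ?_)
      linarith

/-! ### Independence of the past and the next innovation -/

lemma measurable_mulVec {d r : ℕ} {b : E d → E d} {σ : E d → Matrix (Fin d) (Fin r) ℝ}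
    (hbσ : Coefficients b σ) {Ω : Type*} [MeasurableSpace Ω] {X : Ω → E d} {Y : Ω → E r}
    (hX : Measurable X) (hY : Measurable Y) :
    Measurable fun ω => (WithLp.toLp 2 (σ (X ω) *ᵥ (Y ω).ofLp) : E d) := by
  obtain ⟨L, hL⟩ := hbσ.lipschitz_σ
  have hσ : ∀ i j, Measurable fun x => σ x i j := fun i j => by
    refine Continuous.measurable (LipschitzWith.continuous (K := L.toNNReal) ?_)
    refine LipschitzWith.of_dist_le_mul fun x y => ?_
    rw [Real.dist_eq, dist_eq_norm, ← Matrix.sub_apply]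
    exact (abs_apply_le_frob _ i j).trans ((hL x y).trans
      (mul_le_mul_of_nonneg_right (Real.le_coe_toNNReal L) (norm_nonneg _)))
  refine (WithLp.measurable_toLp 2 _).comp (measurable_pi_lambda _ fun i => ?_)
  simp only [Matrix.mulVec, dotProduct]
  refine Finset.measurable_sum _ fun j _ => ((hσ i j).comp hX).mul ?_
  fun_prop

lemma measurable_eulerStep {d r : ℕ} {b : E d → E d} {σ : E d → Matrix (Fin d) (Fin r) ℝ}
    (hbσ : Coefficients b σ) {Ω : Type*} [MeasurableSpace Ω] {X : Ω → E d} {Y : Ω → E r}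
    (hX : Measurable X) (hY : Measurable Y) (g : ℝ) :
    Measurable fun ω => X ω + g • b (X ω)
      + Real.sqrt g • (WithLp.toLp 2 (σ (X ω) *ᵥ (Y ω).ofLp) : E d) := by
  obtain ⟨L, hL⟩ := hbσ.lipschitz_b
  have h1 : Measurable fun ω => b (X ω) := hL.continuous.measurable.comp hX
  have h2 := measurable_mulVec hbσ hX hY
  exact (hX.add (h1.const_smul g)).add (h2.const_smul (Real.sqrt g))

lemma measurable_scheme {d r : ℕ} {b : E d → E d} {σ : E d → Matrix (Fin d) (Fin r) ℝ}
    (hbσ : Coefficients b σ) {Ω : Type*} [MeasurableSpace Ω] (γ : ℕ → ℝ) {X₀ : Ω → E d}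
    {U : ℕ → Ω → E r} (hX₀ : Measurable X₀) (hU : ∀ k, Measurable (U (k + 1))) (n : ℕ) :
    Measurable (scheme b σ γ X₀ U n) := by
  induction n with
  | zero => exact hX₀
  | succ n ih => exact measurable_eulerStep hbσ ih (hU n) (γ (n + 1))

lemma scheme_congr {d r : ℕ} (b : E d → E d) (σ : E d → Matrix (Fin d) (Fin r) ℝ) (γ : ℕ → ℝ)
    {Ω Ω' : Type*} {X₀ : Ω → E d} {U : ℕ → Ω → E r} {X₀' : Ω' → E d} {U' : ℕ → Ω' → E r}
    {ω : Ω} {ω' : Ω'} (h₀ : X₀ ω = X₀' ω') (n : ℕ)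
    (h : ∀ k < n, U (k + 1) ω = U' (k + 1) ω') :
    scheme b σ γ X₀ U n ω = scheme b σ γ X₀' U' n ω' := by
  induction n with
  | zero => exact h₀
  | succ n ih =>
    simp only [scheme, ih fun k hk => h k (hk.trans n.lt_succ_self), h n n.lt_succ_self]

/-- If `A` is independent of `(B, C)` and `B` of `C`, then `(A, B)` is independent of `C`. -/
lemma indepFun_prodMk_of_indepFun {Ω α β δ : Type*} [MeasurableSpace Ω] [MeasurableSpace α]
    [MeasurableSpace β] [MeasurableSpace δ] {P : Measure Ω} [IsProbabilityMeasure P]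
    {A : Ω → α} {B : Ω → β} {C : Ω → δ} (hA : Measurable A) (hB : Measurable B)
    (hC : Measurable C) (h1 : IndepFun A (fun ω => (B ω, C ω)) P) (h2 : IndepFun B C P) :
    IndepFun (fun ω => (A ω, B ω)) C P := by
  have h3 : IndepFun A B P := h1.comp measurable_id measurable_fst
  rw [indepFun_iff_map_prod_eq_prod_map_map hA.aemeasurable (hB.prodMk hC).aemeasurable,
    (indepFun_iff_map_prod_eq_prod_map_map hB.aemeasurable hC.aemeasurable).1 h2] at h1
  rw [indepFun_iff_map_prod_eq_prod_map_map (hA.prodMk hB).aemeasurable hC.aemeasurable,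
    (indepFun_iff_map_prod_eq_prod_map_map hA.aemeasurable hB.aemeasurable).1 h3]
  have := Measure.isProbabilityMeasure_map (μ := P) hA.aemeasurable
  have := Measure.isProbabilityMeasure_map (μ := P) hB.aemeasurable
  have := Measure.isProbabilityMeasure_map (μ := P) hC.aemeasurable
  have h4 := (measurePreserving_prodAssoc (P.map A) (P.map B) (P.map C)).symm
  rw [← h4.map_eq, ← h1, Measure.map_map MeasurableEquiv.prodAssoc.symm.measurable
    (hA.prodMk (hB.prodMk hC))]
  rfl

/-- The occupation sum `∑ γₖ V(Xₖ₋₁)` along the first `n` steps. -/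
noncomputable def occupation {d : ℕ} (γ : ℕ → ℝ) (V : E d → ℝ) (X : ℕ → E d) (n : ℕ) : ℝ :=
  ∑ k ∈ Finset.range n, γ (k + 1) * V (X k)

lemma RandomInput.indepFun_scheme {d r : ℕ} {b : E d → E d}
    {σ : E d → Matrix (Fin d) (Fin r) ℝ} (hbσ : Coefficients b σ) {V : E d → ℝ}
    (hV : Measurable V) {Ω : Type*} [MeasurableSpace Ω] {P : Measure Ω} {μ : Measure (E r)}
    {l₀ : ℝ} {M : ℝ → ℝ≥0} {X₀ : Ω → E d} {U : ℕ → Ω → E r}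
    (h : RandomInput P μ l₀ M X₀ U) (γ : ℕ → ℝ) (n : ℕ) :
    IndepFun (fun ω => (scheme b σ γ X₀ U n ω,
      occupation γ V (fun k => scheme b σ γ X₀ U k ω) n)) (U (n + 1)) P := by
  have := h.prob
  have hB : Measurable fun ω (j : Finset.range n) => U (j + 1) ω :=
    measurable_pi_lambda _ fun j => h.measurable_U j
  have h1 : IndepFun (fun ω (j : Finset.range n) => U (j + 1) ω) (U (n + 1)) P :=
    (h.indep_U.indepFun_finset (Finset.range n) {n} (by simp) h.measurable_U).comp measurable_id
      (measurable_pi_apply (⟨n, by simp⟩ : ({n} : Finset ℕ)))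
  have h2 : IndepFun X₀ (fun ω => ((fun j : Finset.range n => U (j + 1) ω), U (n + 1) ω)) P :=
    h.indep_X₀.comp (ψ := fun u : ℕ → E r => ((fun j : Finset.range n => u j), u n))
      measurable_id ((measurable_pi_lambda _ fun j => measurable_pi_apply _).prodMk
        (measurable_pi_apply n))
  have h3 := indepFun_prodMk_of_indepFun h.measurable_X₀ hB (h.measurable_U n) h2 h1
  -- the scheme run on the canonical space of the initial value and the first `n` innovations
  let U' : ℕ → E d × (Finset.range n → E r) → E r :=
    fun k p => if hk : k - 1 ∈ Finset.range n then p.2 ⟨k - 1, hk⟩ else 0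
  have hU' : ∀ k, Measurable (U' (k + 1)) := fun k => by
    by_cases hk : k ∈ Finset.range n
    · simp only [U', Nat.add_sub_cancel, hk, dif_pos]
      exact (measurable_pi_apply _).comp measurable_snd
    · simp only [U', Nat.add_sub_cancel, hk, dif_neg, not_false_iff]
      exact measurable_const
  have hS : ∀ k, Measurable (scheme b σ γ Prod.fst U' k) :=
    measurable_scheme hbσ γ measurable_fst hU'
  have h4 := h3.comp (φ := fun p => (scheme b σ γ Prod.fst U' n p,
    occupation γ V (fun k => scheme b σ γ Prod.fst U' k p) n))
    ((hS n).prodMk (Finset.measurable_sum _ fun k _ => (hV.comp (hS k)).const_mul _))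
    measurable_id
  have hcongr : ∀ ω, ∀ k ≤ n, scheme b σ γ Prod.fst U' k
      (X₀ ω, fun j : Finset.range n => U (j + 1) ω) = scheme b σ γ X₀ U k ω := fun ω k hk =>
    scheme_congr (ω := (X₀ ω, fun j : Finset.range n => U (j + 1) ω)) (ω' := ω) b σ γ rfl k
      fun j hj => by simp [U', hj.trans_le hk]
  rw [Function.id_comp] at h4
  convert h4 using 1
  funext ω
  simp only [Function.comp_apply, hcongr ω n le_rfl, occupation]
  congr 1
  exact Finset.sum_congr rfl fun k hk => by rw [hcongr ω k (Finset.mem_range.1 hk).le]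

/-- Exponential moments of the Lyapunov function and of its occupation sum along the scheme. -/
lemma lintegral_exp_occupation_le {d r : ℕ} {b : E d → E d}
    {σ : E d → Matrix (Fin d) (Fin r) ℝ} (hbσ : Coefficients b σ) {V : E d → ℝ}
    (hV : Measurable V) {Ω : Type*} [MeasurableSpace Ω] {P : Measure Ω} {μ : Measure (E r)}
    {l₀ : ℝ} {M : ℝ → ℝ≥0} {X₀ : Ω → E d} {U : ℕ → Ω → E r}
    (h : RandomInput P μ l₀ M X₀ U) {γ : ℕ → ℝ} {l q D : ℝ}
    (hstep : ∀ (k : ℕ) (x : E d),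
      ∫⁻ u, ENNReal.ofReal (Real.exp (l * V (x + γ (k + 1) • b x
          + Real.sqrt (γ (k + 1)) • (WithLp.toLp 2 (σ x *ᵥ u.ofLp) : E d))
          + q * (γ (k + 1) * V x))) ∂μ
        ≤ ENNReal.ofReal (Real.exp (l * V x + D * γ (k + 1)))) (n : ℕ) :
    ∫⁻ ω, ENNReal.ofReal (Real.exp (l * V (scheme b σ γ X₀ U n ω)
        + q * occupation γ V (fun k => scheme b σ γ X₀ U k ω) n)) ∂P
      ≤ ENNReal.ofReal (Real.exp (D * Gam γ n)) *
        ∫⁻ ω, ENNReal.ofReal (Real.exp (l * V (X₀ ω))) ∂P := by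
  have := h.prob
  have hU := h.measurable_U
  have hX := measurable_scheme hbσ γ h.measurable_X₀ hU
  induction n with
  | zero => simp [scheme, occupation, Gam]
  | succ n ih =>
    set T : Ω → E d × ℝ := fun ω => (scheme b σ γ X₀ U n ω,
      occupation γ V (fun k => scheme b σ γ X₀ U k ω) n)
    have hT : Measurable T :=
      (hX n).prodMk (Finset.measurable_sum _ fun k _ => (hV.comp (hX k)).const_mul _)
    have hind := (indepFun_iff_map_prod_eq_prod_map_map hT.aemeasurable
      (hU n).aemeasurable).1 (h.indepFun_scheme hbσ hV γ n)
    rw [h.law_U n] at hind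
    have hμ : IsProbabilityMeasure μ :=
      h.law_U n ▸ Measure.isProbabilityMeasure_map (hU n).aemeasurable
    -- the integrand as a function of the past and of the next innovation
    let F : (E d × ℝ) × E r → ℝ≥0∞ := fun p =>
      ENNReal.ofReal (Real.exp (l * V (p.1.1 + γ (n + 1) • b p.1.1
        + Real.sqrt (γ (n + 1)) • (WithLp.toLp 2 (σ p.1.1 *ᵥ p.2.ofLp) : E d))
        + q * (γ (n + 1) * V p.1.1) + q * p.1.2))
    have hnext : Measurable fun p : (E d × ℝ) × E r => p.1.1 + γ (n + 1) • b p.1.1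
        + Real.sqrt (γ (n + 1)) • (WithLp.toLp 2 (σ p.1.1 *ᵥ p.2.ofLp) : E d) :=
      measurable_eulerStep hbσ measurable_fst.fst measurable_snd (γ (n + 1))
    have hF : Measurable F :=
      ENNReal.measurable_ofReal.comp (Real.measurable_exp.comp
        ((((hV.comp hnext).const_mul l).add
          (((hV.comp measurable_fst.fst).const_mul _).const_mul q)).add
          (measurable_fst.snd.const_mul q)))
    calc _ = ∫⁻ ω, F (T ω, U (n + 1) ω) ∂P := by
          refine lintegral_congr fun ω => ?_
          simp only [F, T, occupation, scheme, Finset.sum_range_succ]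
          ring_nf
      _ = ∫⁻ t, ∫⁻ u, F (t, u) ∂μ ∂(P.map T) := by
        rw [← lintegral_prod _ hF.aemeasurable, ← hind, lintegral_map hF (hT.prodMk (hU n))]
      _ ≤ ∫⁻ t, ENNReal.ofReal (Real.exp (D * γ (n + 1))) *
            ENNReal.ofReal (Real.exp (l * V t.1 + q * t.2)) ∂(P.map T) := by
        refine lintegral_mono fun t => ?_
        calc _ = (∫⁻ u, ENNReal.ofReal (Real.exp (l * V (t.1 + γ (n + 1) • b t.1
                + Real.sqrt (γ (n + 1)) • (WithLp.toLp 2 (σ t.1 *ᵥ u.ofLp) : E d))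
                + q * (γ (n + 1) * V t.1))) ∂μ) * ENNReal.ofReal (Real.exp (q * t.2)) := by
              rw [← lintegral_mul_const' _ _ ENNReal.ofReal_ne_top]
              refine lintegral_congr fun u => ?_
              rw [← ENNReal.ofReal_mul (Real.exp_pos _).le, ← Real.exp_add]
          _ ≤ _ := mul_le_mul_left (hstep n t.1) _
          _ = _ := by
            rw [← ENNReal.ofReal_mul (Real.exp_pos _).le,
              ← ENNReal.ofReal_mul (Real.exp_pos _).le, ← Real.exp_add, ← Real.exp_add]
            ring_nf
      _ = ENNReal.ofReal (Real.exp (D * γ (n + 1))) *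
            ∫⁻ ω, ENNReal.ofReal (Real.exp (l * V (T ω).1 + q * (T ω).2)) ∂P := by
        have hm : Measurable fun t : E d × ℝ =>
            ENNReal.ofReal (Real.exp (l * V t.1 + q * t.2)) :=
          ENNReal.measurable_ofReal.comp (Real.measurable_exp.comp
            (((hV.comp measurable_fst).const_mul l).add (measurable_snd.const_mul q)))
        rw [lintegral_const_mul _ hm, lintegral_map hm hT]
      _ ≤ _ := by
        refine (mul_le_mul_right ih _).trans (le_of_eq ?_)
        rw [← mul_assoc, ← ENNReal.ofReal_mul (Real.exp_pos _).le, ← Real.exp_add, Gam, Gam,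
          Finset.sum_range_succ]
        ring_nf

/-! ### The deviation inequality -/

lemma exists_lyapunov_le_sq {d : ℕ} {V : E d → ℝ} (hV : Continuous V) {CV αV θ : ℝ} {γ : ℕ → ℝ}
    (hγ : Steps V CV αV θ γ) :
    ∃ B c : ℝ, 0 < c ∧ ∀ x, V x ≤ B + c * ‖x‖ ^ 2 := by
  obtain ⟨K, c, -, hc, h, -⟩ := hγ.small
  obtain ⟨B, hB⟩ := (isCompact_closedBall (0 : E d) K).bddAbove_image hV.continuousOn
  refine ⟨max B 0, c, hc, fun x => ?_⟩
  rcases le_total K ‖x‖ with hx | hx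
  · linarith [h x hx, le_max_right B 0]
  · have := hB ⟨x, by simpa using hx, rfl⟩
    nlinarith [le_max_left B 0, sq_nonneg ‖x‖]

/-- A non-sharp deviation inequality valid for all `n` and `a`: Markov's inequality for the
exponential moments of the occupation sum, which dominates the square of the deviation. -/
lemma exists_deviation_le.{u} {d r : ℕ} {b : E d → E d} {σ : E d → Matrix (Fin d) (Fin r) ℝ}
    (hbσ : Coefficients b σ) {V : E d → ℝ} {CV αV βV : ℝ} (hV : Lyapunov b σ V CV αV βV)
    {β : ℝ} {φ : E d → ℝ} (hφ : IsTestFunction b V β φ) {θ : ℝ} {γ : ℕ → ℝ}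
    (hγ : Steps V CV αV θ γ) {l₀ : ℝ} (hl₀ : 0 < l₀) (M : ℝ → ℝ≥0) :
    ∃ B D l : ℝ, 0 ≤ D ∧ 0 < l ∧ ∀ (Ω : Type u) [MeasurableSpace Ω] (P : Measure Ω)
      (μ : Measure (E r)) (X₀ : Ω → E d) (U : ℕ → Ω → E r),
      InnovationLaw μ → RandomInput P μ l₀ M X₀ U → ∀ (n : ℕ) (a : ℝ), 0 < a →
        P.real {ω | a ≤ |Real.sqrt (Gam γ n) *
            empirical γ (fun k => scheme b σ γ X₀ U k ω) n (generator b σ φ)|}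
          ≤ B * Real.exp (D * Gam γ n - l * a ^ 2) := by
  obtain ⟨C, hC, hφC⟩ := exists_abs_generator_le hbσ hV hφ
  obtain ⟨B₀, c, hc, hVc⟩ := exists_lyapunov_le_sq hV.contDiff.continuous hγ
  obtain ⟨l₁, hl₁, hstep⟩ := exists_lintegral_exp_step_le hbσ hV hγ
  obtain ⟨v, hv, hVv⟩ := hV.lower
  have hV0 : ∀ x, 0 ≤ V x := fun x => hv.le.trans (hVv x)
  have hVm : Measurable V := hV.contDiff.continuous.measurable
  have hαV := hV.αV_pos
  -- small enough for the one-step estimate and for `𝔼 exp (l c |X₀|²) < ∞`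
  set l := min l₁ (l₀ / (2 * c))
  have hl : 0 < l := by positivity
  have hlc : l * c < l₀ := by
    have h1 : l * (2 * c) ≤ l₀ := (le_div_iff₀ (by positivity)).1 (min_le_right _ _)
    nlinarith
  obtain ⟨D, hD, hstep⟩ := hstep l hl (min_le_left _ _)
  refine ⟨Real.exp (l * B₀) * M (l * c), D, l * αV / 4 / C ^ 2, hD, by positivity, ?_⟩
  intro Ω _ P μ X₀ U hμ h n a ha
  have hX := measurable_scheme hbσ γ h.measurable_X₀ h.measurable_U
  have h0 : ∫⁻ ω, ENNReal.ofReal (Real.exp (l * V (X₀ ω))) ∂P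
      ≤ ENNReal.ofReal (Real.exp (l * B₀) * M (l * c)) := by
    calc _ ≤ ∫⁻ ω, ENNReal.ofReal (Real.exp (l * B₀)) *
            ENNReal.ofReal (Real.exp (l * c * ‖X₀ ω‖ ^ 2)) ∂P := lintegral_mono fun ω => by
          rw [← ENNReal.ofReal_mul (Real.exp_pos _).le, ← Real.exp_add]
          refine ENNReal.ofReal_le_ofReal (Real.exp_le_exp.2 ?_)
          linarith [mul_le_mul_of_nonneg_left (hVc (X₀ ω)) hl.le]
      _ ≤ _ := by
        rw [lintegral_const_mul' _ _ ENNReal.ofReal_ne_top,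
          ENNReal.ofReal_mul (Real.exp_pos _).le, ENNReal.ofReal_coe_nnreal]
        exact mul_le_mul_right (h.subGaussian _ hlc) _
  have hmom := (lintegral_exp_occupation_le hbσ hVm h (hstep μ hμ) n).trans
    (mul_le_mul_right h0 _)
  set f : Ω → ℝ≥0∞ := fun ω => ENNReal.ofReal (Real.exp (l * V (scheme b σ γ X₀ U n ω)
    + l * αV / 4 * occupation γ V (fun k => scheme b σ γ X₀ U k ω) n))
  have hf : Measurable f :=
    ENNReal.measurable_ofReal.comp (Real.measurable_exp.comp (((hVm.comp (hX n)).const_mul l).add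
      ((Finset.measurable_sum _ fun k _ => (hVm.comp (hX k)).const_mul _).const_mul _)))
  set A := {ω | a ≤ |Real.sqrt (Gam γ n) *
    empirical γ (fun k => scheme b σ γ X₀ U k ω) n (generator b σ φ)|}
  set ε := Real.exp (l * αV / 4 / C ^ 2 * a ^ 2)
  have hA : A ⊆ {ω | ENNReal.ofReal ε ≤ f ω} := by
    intro ω hω
    refine ENNReal.ofReal_le_ofReal (Real.exp_le_exp.2 ?_)
    have h1 := (pow_le_pow_left₀ ha.le hω 2).trans (abs_sqrt_mul_empirical_sq_le hV0 hφC hγ.pos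
      (fun k => scheme b σ γ X₀ U k ω) n)
    have h2 : a ^ 2 / C ^ 2 ≤ occupation γ V (fun k => scheme b σ γ X₀ U k ω) n :=
      (div_le_iff₀' (by positivity)).2 h1
    calc l * αV / 4 / C ^ 2 * a ^ 2 = l * αV / 4 * (a ^ 2 / C ^ 2) := by ring
      _ ≤ l * αV / 4 * occupation γ V (fun k => scheme b σ γ X₀ U k ω) n := by gcongr
      _ ≤ _ := le_add_of_nonneg_left (mul_nonneg hl.le (hV0 _))
  have hmarkov : ENNReal.ofReal ε * P A
      ≤ ENNReal.ofReal (Real.exp (D * Gam γ n) * (Real.exp (l * B₀) * M (l * c))) := by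
    rw [ENNReal.ofReal_mul (Real.exp_pos _).le]
    exact (mul_le_mul_right (measure_mono hA) _).trans
      ((mul_meas_ge_le_lintegral hf _).trans hmom)
  have := h.prob
  have hreal := ENNReal.toReal_mono ENNReal.ofReal_ne_top hmarkov
  rw [ENNReal.toReal_mul, ENNReal.toReal_ofReal (Real.exp_pos _).le,
    ENNReal.toReal_ofReal (by positivity)] at hreal
  rw [Real.exp_sub, mul_div_assoc', le_div_iff₀ (Real.exp_pos _)]
  calc P.real A * ε = ε * (P A).toReal := mul_comm _ _
    _ ≤ _ := hreal
    _ = _ := mul_comm _ _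

/-- For `a ≥ ρ √Γ` with `ρ` large, Gaussian decay in `a` beats any rate `K a^{4/3} Γ^{1/3}`, even
with a prefactor and a factor `exp (D Γ)`. -/
lemma exists_exp_le_of_large {B D K l g : ℝ} (hD : 0 ≤ D) (hl : 0 < l) (hg : 0 < g) :
    ∃ ρ : ℝ, ∀ G a : ℝ, g ≤ G → 0 < a → ρ ≤ a / Real.sqrt G →
      B * Real.exp (D * G - l * a ^ 2)
        ≤ 2 * Real.exp (-(K * (a ^ (4 / 3 : ℝ) * G ^ (1 / 3 : ℝ)))) := by
  set K' := |K|
  set D' := D + 16 * K' ^ 3 / l ^ 2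
  have hK' : 0 ≤ K' := abs_nonneg K
  have hD' : 0 ≤ D' := by positivity
  refine ⟨max 1 (max (4 * D' / l) (4 * |B| / (l * g))), fun G a hG ha hρ => ?_⟩
  set ρ := max 1 (max (4 * D' / l) (4 * |B| / (l * g)))
  have hG0 : 0 < G := hg.trans_le hG
  have hρ1 : 1 ≤ ρ := le_max_left _ _
  have hρD : 4 * D' ≤ ρ * l :=
    (div_le_iff₀ hl).1 ((le_max_left _ _).trans (le_max_right _ _))
  have hρB : 4 * |B| ≤ ρ * (l * g) :=
    (div_le_iff₀ (by positivity)).1 ((le_max_right _ _).trans (le_max_right _ _))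
  have ha2 : ρ * G ≤ a ^ 2 := by
    have h1 := pow_le_pow_left₀ (by positivity) ((le_div_iff₀ (Real.sqrt_pos.2 hG0)).1 hρ) 2
    rw [mul_pow, Real.sq_sqrt hG0.le] at h1
    nlinarith
  -- Young's inequality for `a^{4/3} G^{1/3} = x² y`, with `x³ = a²` and `y³ = G`
  have hyoung : K * (a ^ (4 / 3 : ℝ) * G ^ (1 / 3 : ℝ))
      ≤ l / 4 * a ^ 2 + 16 * K' ^ 3 / l ^ 2 * G := by
    have hx0 : 0 ≤ a ^ (2 / 3 : ℝ) := by positivity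
    have hy0 : 0 ≤ G ^ (1 / 3 : ℝ) := by positivity
    have h1 : a ^ (4 / 3 : ℝ) = (a ^ (2 / 3 : ℝ)) ^ 2 := by
      rw [← Real.rpow_natCast, ← Real.rpow_mul ha.le]
      norm_num
    have h2 : a ^ 2 = (a ^ (2 / 3 : ℝ)) ^ 3 := by
      rw [← Real.rpow_natCast, ← Real.rpow_natCast, ← Real.rpow_mul ha.le]
      norm_num
    have h3 : (G ^ (1 / 3 : ℝ)) ^ 3 = G := by
      rw [← Real.rpow_natCast, ← Real.rpow_mul hG0.le]
      norm_num
    rw [h1, h2]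
    nth_rewrite 2 [← h3]
    generalize a ^ (2 / 3 : ℝ) = x at hx0 ⊢
    generalize G ^ (1 / 3 : ℝ) = y at hy0 ⊢
    have hKx : K * (x ^ 2 * y) ≤ K' * (x ^ 2 * y) :=
      mul_le_mul_of_nonneg_right (le_abs_self K) (by positivity)
    rcases le_total (K' * y) (l / 4 * x) with hxy | hxy
    · have h4 := mul_le_mul_of_nonneg_right hxy (sq_nonneg x)
      have h5 : 0 ≤ 16 * K' ^ 3 / l ^ 2 * y ^ 3 := by positivity
      linarith
    · have hx : x ≤ 4 * K' * y / l := by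
        rw [le_div_iff₀ hl]
        linarith
      have h4 : K' * (x ^ 2 * y) ≤ K' * ((4 * K' * y / l) ^ 2 * y) := by gcongr
      have h5 : K' * ((4 * K' * y / l) ^ 2 * y) = 16 * K' ^ 3 / l ^ 2 * y ^ 3 := by
        field_simp
        ring
      have h6 : 0 ≤ l / 4 * x ^ 3 := by positivity
      linarith
  have hDG : D' * G ≤ l / 4 * a ^ 2 := by nlinarith
  have hBa : |B| ≤ l / 4 * a ^ 2 := by
    nlinarith [mul_le_mul_of_nonneg_left hG (by positivity : 0 ≤ ρ * l)]
  have hB : B ≤ 2 * Real.exp |B| := by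
    linarith [le_abs_self B, Real.add_one_le_exp |B|, Real.exp_pos |B|]
  calc B * Real.exp (D * G - l * a ^ 2)
      ≤ 2 * Real.exp |B| * Real.exp (D * G - l * a ^ 2) :=
        mul_le_mul_of_nonneg_right hB (Real.exp_pos _).le
    _ = 2 * Real.exp (|B| + (D * G - l * a ^ 2)) := by rw [mul_assoc, ← Real.exp_add]
    _ ≤ _ := by
      refine mul_le_mul_of_nonneg_left (Real.exp_le_exp.2 ?_) zero_le_two
      have : D' * G = D * G + 16 * K' ^ 3 / l ^ 2 * G := add_mul _ _ _
      have : 0 ≤ l * a ^ 2 := by positivity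
      linarith

end EulerErgodic

theorem theorem6p1 {d r : ℕ} (b : E d → E d) (σ : E d → Matrix (Fin d) (Fin r) ℝ)
    (hbσ : Coefficients b σ)
    (V : E d → ℝ) (CV αV βV : ℝ) (hV : Lyapunov b σ V CV αV βV)
    (ν : Measure (E d)) (hν : IsUniqueInvariant b σ ν)
    (β : ℝ) (hβ : β ∈ Set.Ioc (0 : ℝ) 1)
    (φ : E d → ℝ) (hφ : IsTestFunction b V β φ)
    (ϑ : E d → ℝ) (hϑ : IsTestFunction b V β ϑ)
    (hPoisson : ∀ x, generator b σ ϑ x = carreDuChamp σ φ x - ∫ y, carreDuChamp σ φ y ∂ν)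
    (θ : ℝ) (hθ : θ ∈ Set.Ioc (1 / (2 + β)) 1)
    (γ : ℕ → ℝ) (hγ : Steps V CV αV θ γ)
    -- threshold and moment bounds for the sub-Gaussian initial condition
    (l₀ : ℝ) (hl₀ : 0 < l₀) (M : ℝ → ℝ≥0)
    -- super Gaussian deviations: `a / √Γ_n ≥ R_n → +∞`
    (R : ℕ → ℝ) (hR : Tendsto R atTop atTop) :
    ∃ c C : ℕ → ℝ,
      (∀ n, 0 ≤ c n ∧ 0 ≤ C n) ∧
      (∃ N, MonotoneOn c (Set.Ici N) ∧ AntitoneOn C (Set.Ici N)) ∧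
      Tendsto c atTop (𝓝 1) ∧ Tendsto C atTop (𝓝 1) ∧
      ∀ (Ω : Type*) [MeasurableSpace Ω] (P : Measure Ω) (μ : Measure (E r))
        (X₀ : Ω → E d) (U : ℕ → Ω → E r),
        InnovationLaw μ → RandomInput P μ l₀ M X₀ U →
        ∀ n : ℕ, 1 ≤ n → ∀ a : ℝ, 0 < a → R n ≤ a / Real.sqrt (Gam γ n) →
          P.real {ω | a ≤ |Real.sqrt (Gam γ n) *
              empirical γ (fun k => scheme b σ γ X₀ U k ω) n (generator b σ φ)|}
            ≤ 2 * C n * Real.exp (-(c n * (a ^ (4 / 3 : ℝ) * Gam γ n ^ (1 / 3 : ℝ) /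
                (2 * supNorm σ ^ (2 / 3 : ℝ) * holderModulus 1 ϑ ^ (2 / 3 : ℝ))))) := by
  obtain ⟨B, D, l, hD, hl, hdev⟩ := exists_deviation_le hbσ hV hφ hγ hl₀ M
  set K := 1 / (2 * supNorm σ ^ (2 / 3 : ℝ) * holderModulus 1 ϑ ^ (2 / 3 : ℝ))
  obtain ⟨ρ, hρ⟩ := exists_exp_le_of_large (B := B) (K := K) hD hl (hγ.pos 1 le_rfl)
  obtain ⟨N, hN⟩ := eventually_atTop.1 (hR.eventually_ge_atTop ρ)
  refine ⟨fun n => if n < N then 0 else 1, fun _ => 1, fun n => ⟨by positivity, zero_le_one⟩,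
    ⟨N, fun m hm n hn _ => ?_, fun _ _ _ _ _ => le_rfl⟩, ?_, tendsto_const_nhds, ?_⟩
  · simp [not_lt.2 (Set.mem_Ici.1 hm), not_lt.2 (Set.mem_Ici.1 hn)]
  · refine tendsto_const_nhds.congr' ?_
    filter_upwards [eventually_ge_atTop N] with n hn
    simp [not_lt.2 hn]
  intro Ω _ P μ X₀ U hμ h n hn a ha hRa
  have := h.prob
  rcases lt_or_ge n N with hnN | hnN
  · -- the bound is at least `1`
    have := measureReal_le_one (μ := P) (s := {ω | a ≤ |Real.sqrt (Gam γ n) *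
      empirical γ (fun k => scheme b σ γ X₀ U k ω) n (generator b σ φ)|})
    simp only [hnN, if_true, zero_mul, neg_zero, Real.exp_zero]
    linarith
  · have hG : γ 1 ≤ Gam γ n :=
      Finset.single_le_sum (f := fun k => γ (k + 1)) (fun k _ => (hγ.pos (k + 1) (by omega)).le)
        (Finset.mem_range.2 (show 0 < n by omega))
    refine (hdev Ω P μ X₀ U hμ h n a ha).trans ((hρ _ a hG ha ((hN n hnN).trans hRa)).trans
      (le_of_eq ?_))
    simp only [not_lt.2 hnN, if_false, one_mul, mul_one, K]
    ring_nf
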